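/- Let $X,Y$ denote compact metric spaces, $\dim$ the covering dimension ($\dim\emptyset=-1$), and $C(X,Y)$ the space of continuous maps $X\to Y$ with the topology of uniform convergence. A continuum is a nonempty compact connected metric space; it is nondegenerate if it has more than one point. A space $Y$ is $LC^n$ if for every $y\in Y$, every $k\in\{0,\dots,n\}$ and every neighbourhood $U$ of $y$ there is a neighbourhood $V\subset U$ of $y$ such that every continuous map $S^k\to V$ extends to a continuous map $B^{k+1}\to U$, where $B^{k+1}$ is the closed unit ball of $\mathbb{R}^{k+1}$ and $S^k$ its boundary sphere. For $f\in C(X,Y)$ let $F(f)\subset X$ be the union of all nondegenerate (i.e. having more than one point) connected components of all fibers $f^{-1}(y)$, $y\in Y$, and let $$L_n(X,Y)=\{f\in C(X,Y):\dim F(f)\le n\}$$ be the set of $n$-dimensional Lelek maps. **Theorem.** Let $n\ge 0$ be an integer, let $X$ be a compact metric space with $\dim X=n+1$, and let $Y$ be a nondegenerate $LC^n$-continuum. Then $L_n(X,Y)$ is a dense $G_\delta$ subset of $C(X,Y)$. -/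

import Mathlib

open Set Topology

/-- `CoveringDimLT X m`: every finite open cover of `X` has a finite open refinement (again a cover
of `X`) such that each point lies in at most `m` of its members. For `m = k + 1` this says that the
Čech–Lebesgue covering dimension of `X` is at most `k`; for `m = 0` it says that `X` is empty. -/
def CoveringDimLT (X : Type*) [TopologicalSpace X] (m : ℕ) : Prop :=
  ∀ 𝒰 : Set (Set X), 𝒰.Finite → (∀ U ∈ 𝒰, IsOpen U) → ⋃₀ 𝒰 = univ →
    ∃ 𝒱 : Set (Set X), 𝒱.Finite ∧ (∀ V ∈ 𝒱, IsOpen V) ∧ ⋃₀ 𝒱 = univ ∧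
      (∀ V ∈ 𝒱, ∃ U ∈ 𝒰, V ⊆ U) ∧ ∀ x : X, {V ∈ 𝒱 | x ∈ V}.encard ≤ m

/-- The covering dimension of a space, with `⊥` (that is, `-1`) for the empty space and `⊤` for
infinite-dimensional spaces. -/
noncomputable def coveringDim (X : Type*) [TopologicalSpace X] : WithBot ℕ∞ :=
  sInf {d | ∀ m : ℕ, d < m → CoveringDimLT X m}

theorem CoveringDimLT.mono {X : Type*} [TopologicalSpace X] {m k : ℕ} (h : CoveringDimLT X m)
    (hmk : m ≤ k) : CoveringDimLT X k := by
  intro 𝒰 h1 h2 h3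
  obtain ⟨𝒱, a, b, c, d, e⟩ := h 𝒰 h1 h2 h3
  exact ⟨𝒱, a, b, c, d, fun x => (e x).trans (by exact_mod_cast hmk)⟩

theorem coveringDim_le_iff {X : Type*} [TopologicalSpace X] {n : ℕ} :
    coveringDim X ≤ n ↔ CoveringDimLT X (n + 1) := by
  constructor
  · intro h
    by_contra hc
    have h' : ((n + 1 : ℕ) : WithBot ℕ∞) ≤ coveringDim X := by
      refine le_sInf fun d hd => ?_
      by_contra hlt
      exact hc (hd _ (not_le.mp hlt))
    have h'' : ((n + 1 : ℕ) : WithBot ℕ∞) ≤ (n : ℕ) := h'.trans h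
    have : n + 1 ≤ n := by exact_mod_cast h''
    omega
  · intro h
    refine sInf_le fun m hm => h.mono ?_
    have : n < m := by exact_mod_cast hm
    omega

/-- `Y` is an `LCⁿ`-space: for each `k ≤ n`, each point `y` and each neighbourhood `U` of `y`
there is a neighbourhood `V ⊆ U` of `y` such that every continuous map of the `k`-sphere into `V`
extends to a continuous map of the `(k+1)`-ball into `U` (equivalently, is null-homotopic
in `U`). -/
def IsLC (n : ℕ) (Y : Type*) [TopologicalSpace Y] : Prop :=
  ∀ k : ℕ, k ≤ n → ∀ y : Y, ∀ U ∈ 𝓝 y, ∃ V ∈ 𝓝 y, V ⊆ U ∧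
    ∀ φ : EuclideanSpace ℝ (Fin (k + 1)) → Y,
      ContinuousOn φ (Metric.sphere 0 1) → MapsTo φ (Metric.sphere 0 1) V →
      ∃ ψ : EuclideanSpace ℝ (Fin (k + 1)) → Y,
        ContinuousOn ψ (Metric.closedBall 0 1) ∧ MapsTo ψ (Metric.closedBall 0 1) U ∧
          EqOn ψ φ (Metric.sphere 0 1)

/-- The union of all nondegenerate connected components of all fibres of `f`. -/
def lelekSet {X Y : Type*} [TopologicalSpace X] (f : X → Y) : Set X :=
  ⋃₀ {B | ∃ y : Y, ∃ x ∈ f ⁻¹' {y}, B = connectedComponentIn (f ⁻¹' {y}) x ∧ B.Nontrivial}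

/-- The set `Lₙ(X,Y)` of `n`-dimensional Lelek maps, inside `C(X, Y)`. -/
def lelekMaps (n : ℕ) (X Y : Type*) [TopologicalSpace X] [TopologicalSpace Y] : Set C(X, Y) :=
  {f | coveringDim (lelekSet f) ≤ n}

/-! Call a point `ε`-unseparated for f if every open set of diameter below `ε` around it has a
frontier point in the same fibre. Such points form a compact set, and F(f) is the union of these
sets over ε = 1/(k+1) (`lelekSet_eq_iUnion_unseparatedSet`), since components of a compact fibre are
quasicomponents. By the countable sum theorem, dim F(f) ≤ n means that each of them has open covers
of order ≤ n + 1 and arbitrarily small mesh (`coveringDim_lelekSet_le_iff`). Each of these countably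
many conditions is open in f, so by Baire it remains to show that each is dense.

For density, take a fine cover of X of order ≤ n + 2. The intersections W_σ of n + 2 members are
pairwise disjoint; let K_σ ⊆ O_σ ⊆ W_σ, with K_σ the intersection of the closures of slightly
shrunken members. Perturb f to equal one constant on K_σ and another on the frontier of O_σ. Then
O_σ separates the points of K_σ, so deleting all K_σ from the shrunken members still covers the
unseparated set, with order ≤ n + 1. The perturbation exists by `IsLC.exists_controlled_extension`:
as dim X ≤ n + 1 and Y is LCⁿ, one maps the nerve of a fine cover skeleton by skeleton, which solves
the extension problem up to a small error, and iterates to remove the error. -/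

/-! ### Small covers and the countable sum theorem -/

/-- `P` has a finite cover by open sets of diameter less than `δ`, at most `m` of which meet at any
point of the ambient space. -/
def HasSmallCover {X : Type*} [MetricSpace X] (P : Set X) (δ : ℝ) (m : ℕ) : Prop :=
  ∃ 𝒱 : Set (Set X), 𝒱.Finite ∧ (∀ V ∈ 𝒱, IsOpen V ∧ ∀ x ∈ V, ∀ y ∈ V, dist x y < δ) ∧
    P ⊆ ⋃₀ 𝒱 ∧ ∀ x, {V ∈ 𝒱 | x ∈ V}.encard ≤ m

theorem encard_image_filter_le {α β γ : Type*} {𝒱 : Set α} {g : α → Set β} {f : α → Set γ}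
    {x : β} {y : γ} (h : ∀ V ∈ 𝒱, x ∈ g V → y ∈ f V) :
    {W ∈ g '' 𝒱 | x ∈ W}.encard ≤ {V ∈ 𝒱 | y ∈ f V}.encard := by
  refine le_trans (encard_le_encard ?_) (encard_image_le g _)
  rintro _ ⟨⟨V, hV, rfl⟩, hx⟩
  exact ⟨V, ⟨hV, h V hV hx⟩, rfl⟩

/-- Extension of open sets from a subspace preserving the intersection pattern. -/
theorem exists_mem_of_infEDist_lt {X : Type*} [MetricSpace X] {F : Set X} {S : Set (Set F)}
    (hS : S.Finite) (hne : S.Nonempty) {x : X}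
    (hx : ∀ V ∈ S, Metric.infEDist x ((↑) '' V) < Metric.infEDist x ((↑) '' Vᶜ : Set X)) :
    ∃ p : F, ∀ V ∈ S, p ∈ V := by
  by_contra! hc
  -- Take the `V₀` whose complement is nearest to `x`: a point of `V₀` closer to `x` than that
  -- complement lies in every `V ∈ S`.
  obtain ⟨V₀, hV₀, hmin⟩ := hS.exists_minimalFor
    (fun V => Metric.infEDist x ((↑) '' Vᶜ : Set X)) S hne
  have hmin' : ∀ V ∈ S, Metric.infEDist x ((↑) '' V₀ᶜ : Set X) ≤
      Metric.infEDist x ((↑) '' Vᶜ : Set X) := fun V hV =>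
    (le_total _ _).elim id fun h => hmin hV h
  obtain ⟨_, ⟨p, -, rfl⟩, hp⟩ := Metric.infEDist_lt_iff.1 (hx V₀ hV₀)
  obtain ⟨V, hV, hpV⟩ := hc p
  have h2 : Metric.infEDist x ((↑) '' Vᶜ : Set X) ≤ edist x p :=
    Metric.infEDist_le_edist_of_mem ⟨p, hpV, rfl⟩
  exact absurd (hp.trans_le ((hmin' V hV).trans h2)) (lt_irrefl _)

theorem exists_finite_small_ball_cover (X : Type*) [MetricSpace X] [CompactSpace X]
    {δ : ℝ} (hδ : 0 < δ) :
    ∃ t : Set X, t.Finite ∧ ⋃ c ∈ t, Metric.ball c (δ / 2) = univ := by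
  obtain ⟨t, -, ht, hcov⟩ := (isCompact_univ (X := X)).finite_cover_balls (half_pos hδ)
  exact ⟨t, ht, univ_subset_iff.1 hcov⟩

theorem dist_lt_of_mem_ball_half {X : Type*} [MetricSpace X] {c x y : X} {δ : ℝ}
    (hx : x ∈ Metric.ball c (δ / 2)) (hy : y ∈ Metric.ball c (δ / 2)) : dist x y < δ := by
  have := dist_triangle_right x y c
  rw [Metric.mem_ball] at hx hy
  linarith

/-- A set `V` open in `F` extends to the points of `X` closer to `V` than to `F \ V`. Extended sets
with a common point come from sets with a common point, so the order is controlled on all of `X`. -/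
theorem CoveringDimLT.hasSmallCover {X : Type*} [MetricSpace X] [CompactSpace X] {F : Set X}
    {m : ℕ} (h : CoveringDimLT F m) {δ : ℝ} (hδ : 0 < δ) : HasSmallCover F δ m := by
  obtain ⟨t, ht, hcov⟩ := exists_finite_small_ball_cover X hδ
  obtain ⟨𝒱, hfin, hopen, hcv, href, hord⟩ := h
    ((fun c => ((↑) ⁻¹' Metric.ball c (δ / 2) : Set F)) '' t) (ht.image _)
    (by rintro _ ⟨c, -, rfl⟩; exact Metric.isOpen_ball.preimage continuous_subtype_val)
    (by
      refine eq_univ_of_forall fun p => ?_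
      have : (p : X) ∈ ⋃ c ∈ t, Metric.ball c (δ / 2) := hcov ▸ mem_univ _
      obtain ⟨c, hc, hp⟩ := mem_iUnion₂.1 this
      exact ⟨_, ⟨c, hc, rfl⟩, hp⟩)
  have href' : ∀ V ∈ 𝒱, ∃ B : Set X, IsOpen B ∧ (∀ x ∈ B, ∀ y ∈ B, dist x y < δ) ∧
      V ⊆ ((↑) ⁻¹' B : Set F) := by
    intro V hV
    obtain ⟨_, ⟨c, -, rfl⟩, hc⟩ := href V hV
    exact ⟨_, Metric.isOpen_ball, fun x hx y hy => dist_lt_of_mem_ball_half hx hy, hc⟩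
  choose! B hBo hBd hB using href'
  let g : Set F → Set X := fun V =>
    {x | Metric.infEDist x ((↑) '' V) < Metric.infEDist x ((↑) '' Vᶜ : Set X)} ∩ B V
  refine ⟨g '' 𝒱, hfin.image _, ?_, ?_, fun x => ?_⟩
  · rintro _ ⟨V, hV, rfl⟩
    exact ⟨(isOpen_lt Metric.continuous_infEDist Metric.continuous_infEDist).inter
      (hBo V hV), fun x hx y hy => hBd V hV x hx.2 y hy.2⟩
  · intro x hx
    obtain ⟨V, hV, hxV⟩ : (⟨x, hx⟩ : F) ∈ ⋃₀ 𝒱 := hcv ▸ mem_univ _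
    refine ⟨g V, ⟨V, hV, rfl⟩, ?_, hB V hV hxV⟩
    have h0 : Metric.infEDist x ((↑) '' V : Set X) = 0 :=
      Metric.infEDist_zero_of_mem ⟨_, hxV, rfl⟩
    rw [mem_ofPred_eq, h0, pos_iff_ne_zero]
    intro h1
    obtain ⟨O, hO, hOV⟩ := isOpen_induced_iff.1 (hopen V hV)
    rw [← Metric.mem_closure_iff_infEDist_zero, mem_closure_iff] at h1
    have hxO : x ∈ O := by
      have : (⟨x, hx⟩ : F) ∈ (↑) ⁻¹' O := hOV ▸ hxV
      exact this
    obtain ⟨_, hpO, p, hp, rfl⟩ := h1 O hO hxO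
    exact hp (hOV ▸ hpO)
  · rcases {V ∈ 𝒱 | x ∈ g V}.eq_empty_or_nonempty with he | hne
    · refine (encard_image_filter_le (f := g) (y := x) fun _ _ h => h).trans ?_
      simp [he]
    · obtain ⟨p, hp⟩ := exists_mem_of_infEDist_lt (hfin.subset fun V hV => hV.1) hne
        (x := x) fun V hV => hV.2.1
      exact (encard_image_filter_le (f := id) (y := p) fun V hV hx => hp V ⟨hV, hx⟩).trans (hord p)

theorem CoveringDimLT.hasSmallCover_univ {X : Type*} [MetricSpace X] [CompactSpace X]
    {m : ℕ} (h : CoveringDimLT X m) {δ : ℝ} (hδ : 0 < δ) : HasSmallCover (univ : Set X) δ m := by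
  obtain ⟨t, ht, hcov⟩ := exists_finite_small_ball_cover X hδ
  obtain ⟨𝒱, hfin, hopen, hcv, href, hord⟩ := h
    ((fun c => Metric.ball c (δ / 2)) '' t) (ht.image _)
    (by rintro _ ⟨c, -, rfl⟩; exact Metric.isOpen_ball)
    (by rw [sUnion_image, hcov])
  refine ⟨𝒱, hfin, fun V hV => ⟨hopen V hV, fun x hx y hy => ?_⟩, hcv.ge, hord⟩
  obtain ⟨_, ⟨c, -, rfl⟩, hc⟩ := href V hV
  exact dist_lt_of_mem_ball_half (hc hx) (hc hy)

theorem HasSmallCover.mono {X : Type*} [MetricSpace X] {P Q : Set X} {δ : ℝ} {m : ℕ}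
    (h : HasSmallCover Q δ m) (hPQ : P ⊆ Q) : HasSmallCover P δ m := by
  obtain ⟨𝒱, h1, h2, h3, h4⟩ := h
  exact ⟨𝒱, h1, h2, hPQ.trans h3, h4⟩

theorem HasSmallCover.preimage_val {X : Type*} [MetricSpace X] {P F : Set X} {δ : ℝ} {m : ℕ}
    (h : HasSmallCover P δ m) : HasSmallCover ((↑) ⁻¹' P : Set F) δ m := by
  obtain ⟨𝒱, h1, h2, h3, h4⟩ := h
  refine ⟨preimage (↑) '' 𝒱, h1.image _, ?_, ?_, fun x => ?_⟩
  · rintro _ ⟨V, hV, rfl⟩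
    exact ⟨(h2 V hV).1.preimage continuous_subtype_val, fun x hx y hy => (h2 V hV).2 x hx y hy⟩
  · intro x hx
    obtain ⟨V, hV, hxV⟩ := h3 hx
    exact ⟨_, ⟨V, hV, rfl⟩, hxV⟩
  · exact (encard_image_filter_le (g := preimage ((↑) : F → X)) (f := id) (x := x) (y := (x : X))
      fun _ _ h => h).trans (h4 x)

theorem exists_finset_of_lt_encard {ι : Type*} [Finite ι] {s : Set ι} {m : ℕ}
    (h : ¬ s.encard ≤ m) : ∃ t : Finset ι, t.card = m + 1 ∧ ∀ i ∈ t, i ∈ s := by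
  obtain ⟨t, hts, ht⟩ := exists_subset_encard_eq (s := s) (k := ((m + 1 : ℕ) : ℕ∞))
    (by push_cast; exact Order.add_one_le_of_lt (not_le.1 h))
  refine ⟨t.toFinite.toFinset, ?_, fun i hi => hts (by simpa using hi)⟩
  rw [(t.toFinite).encard_eq_coe_toFinset_card] at ht
  exact_mod_cast ht

/-- A finite closed family can be enlarged to an open family of the same order. -/
theorem exists_open_swelling {Z ι : Type*} [MetricSpace Z] [Finite ι] {F U : ι → Set Z} {m : ℕ}
    (hF : ∀ i, IsClosed (F i)) (hU : ∀ i, IsOpen (U i)) (hFU : ∀ i, F i ⊆ U i)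
    (hord : ∀ x, {i | x ∈ F i}.encard ≤ m) :
    ∃ G : ι → Set Z, (∀ i, IsOpen (G i)) ∧ (∀ i, F i ⊆ G i) ∧ (∀ i, G i ⊆ U i) ∧
      ∀ x, {i | x ∈ G i}.encard ≤ m := by
  -- Among any `m + 1` indices, some `F j` must be strictly farther from `x` than `F i`. If `x` lay
  -- in `m + 1` of the sets `G i`, the index with the farthest `F i` would violate this.
  let G : ι → Set Z := fun i => U i ∩ ⋂ s ∈ {s : Finset ι | s.card = m + 1},
    ⋃ j ∈ s, {x | Metric.infEDist x (F i) < Metric.infEDist x (F j)}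
  refine ⟨G, fun i => (hU i).inter ?_, fun i x hx => ⟨hFU i hx, ?_⟩, fun i x hx => hx.1,
    fun x => ?_⟩
  · exact (toFinite _).isOpen_biInter fun s _ => isOpen_biUnion fun j _ =>
      isOpen_lt Metric.continuous_infEDist Metric.continuous_infEDist
  · refine mem_iInter₂.2 fun s hs => ?_
    by_contra hc
    simp only [mem_iUnion, not_exists] at hc
    have : (s : Set ι) ⊆ {i | x ∈ F i} := by
      intro j hj
      have h1 := hc j hj
      rw [mem_ofPred_eq, Metric.infEDist_zero_of_mem hx, not_lt, nonpos_iff_eq_zero] at h1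
      exact (Metric.mem_iff_infEDist_zero_of_closed (hF j)).2 h1
    have h2 := (encard_le_encard this).trans (hord x)
    rw [encard_coe_eq_coe_finsetCard, hs] at h2
    norm_cast at h2
    omega
  · by_contra hc
    obtain ⟨t, ht, htG⟩ := exists_finset_of_lt_encard hc
    obtain ⟨i, hi, hmax⟩ := t.exists_max_image (fun j => Metric.infEDist x (F j))
      (Finset.card_pos.1 (by omega))
    obtain ⟨j, hj, hlt⟩ := mem_iUnion₂.1 (mem_iInter₂.1 (htG i hi).2 t ht)
    exact absurd (hmax j hj) (not_le.2 hlt)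

/-- One stage of the sum theorem: lower the order on the compact piece `P` while keeping a cover of
the whole space. Near `P`, cover elements below the Lebesgue number are grouped by a `U i`
containing them; off `P` the old sets remain. -/
theorem exists_shrinking_of_hasSmallCover {Z ι : Type*} [MetricSpace Z] [Finite ι] {P : Set Z}
    (hP : IsCompact P) {m : ℕ} (hcov : ∀ δ > 0, HasSmallCover P δ m) {U : ι → Set Z}
    (hU : ∀ i, IsOpen (U i)) (hUc : ⋃ i, U i = univ) :
    ∃ V : ι → Set Z, (∀ i, IsOpen (V i)) ∧ ⋃ i, V i = univ ∧ (∀ i, closure (V i) ⊆ U i) ∧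
      ∀ x ∈ P, {i | x ∈ closure (V i)}.encard ≤ m := by
  rcases isEmpty_or_nonempty ι with hι | hι
  · exact ⟨U, hU, hUc, fun i => isEmptyElim i, fun x _ => by simp [Set.eq_empty_of_isEmpty]⟩
  obtain ⟨δ, hδ, hleb⟩ := lebesgue_number_lemma_of_metric hP hU (hUc ▸ subset_univ P)
  obtain ⟨𝒲, hfin, hW, hPW, hord⟩ := hcov δ hδ
  have key : ∀ W ∈ {W ∈ 𝒲 | (W ∩ P).Nonempty}, ∃ i, W ⊆ U i := by
    rintro W ⟨hW𝒲, p, hpW, hpP⟩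
    obtain ⟨i, hi⟩ := hleb p hpP
    exact ⟨i, fun x hx => hi ((hW W hW𝒲).2 x hx p hpW)⟩
  choose! a ha using key
  let V : ι → Set Z := fun i => (⋃ W ∈ {W ∈ 𝒲 | (W ∩ P).Nonempty ∧ a W = i}, W) ∪ (U i \ P)
  have hVo : ∀ i, IsOpen (V i) := fun i =>
    (isOpen_biUnion fun W hW' => (hW W hW'.1).1).union ((hU i).sdiff hP.isClosed)
  have hVc : ⋃ i, V i = univ := by
    refine eq_univ_of_forall fun x => ?_
    by_cases hx : x ∈ P
    · obtain ⟨W, hW', hxW⟩ := hPW hx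
      exact mem_iUnion.2 ⟨a W, Or.inl (mem_iUnion₂.2 ⟨W, ⟨hW', ⟨x, hxW, hx⟩, rfl⟩, hxW⟩)⟩
    · obtain ⟨i, hi⟩ := mem_iUnion.1 (hUc ▸ mem_univ x)
      exact mem_iUnion.2 ⟨i, Or.inr ⟨hi, hx⟩⟩
  have hVU : ∀ i, V i ⊆ U i := by
    rintro i x (hx | hx)
    · obtain ⟨W, ⟨h1, h2, rfl⟩, h3⟩ := mem_iUnion₂.1 hx
      exact ha W ⟨h1, h2⟩ h3
    · exact hx.1
  obtain ⟨V', hV'c, hV'o, hV'⟩ := exists_iUnion_eq_closure_subset hVo (fun x => toFinite _) hVc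
  refine ⟨V', hV'o, hV'c, fun i => (hV' i).trans (hVU i), fun x hx => ?_⟩
  have hsub : {i | x ∈ closure (V' i)} ⊆ a '' {W ∈ 𝒲 | x ∈ W} := by
    intro i hi
    rcases hV' i hi with h | h
    · obtain ⟨W, ⟨h1, h2, rfl⟩, h3⟩ := mem_iUnion₂.1 h
      exact ⟨W, ⟨h1, h3⟩, rfl⟩
    · exact absurd hx h.2
  exact ((encard_le_encard hsub).trans (encard_image_le _ _)).trans (hord x)

/-- The countable sum theorem for `σ`-compact metric spaces. -/
theorem coveringDimLT_of_iUnion_compact {Z : Type*} [MetricSpace Z] {P : ℕ → Set Z}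
    (hP : ∀ k, IsCompact (P k)) (hPc : ⋃ k, P k = univ) {m : ℕ}
    (hcov : ∀ k, ∀ δ > 0, HasSmallCover (P k) δ m) : CoveringDimLT Z m := by
  intro 𝒰 hfin hopen hUc
  have : Finite 𝒰 := hfin
  let C := {U : 𝒰 → Set Z // (∀ i, IsOpen (U i)) ∧ ⋃ i, U i = univ}
  have step : ∀ (k : ℕ) (U : C), ∃ V : C, (∀ i, closure (V.1 i) ⊆ U.1 i) ∧
      ∀ x ∈ P k, {i | x ∈ closure (V.1 i)}.encard ≤ m := by
    intro k U
    obtain ⟨V, h1, h2, h3, h4⟩ := exists_shrinking_of_hasSmallCover (hP k) (hcov k) U.2.1 U.2.2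
    exact ⟨⟨V, h1, h2⟩, h3, h4⟩
  choose next hsub hnext using step
  let U₀ : C := ⟨fun i => i.1, fun i => hopen _ i.2, by rw [← sUnion_eq_iUnion, hUc]⟩
  let V : ℕ → C := fun k => Nat.rec U₀ next k
  have hV : ∀ k i, closure ((V (k + 1)).1 i) ⊆ (V k).1 i := fun k i => hsub k (V k) i
  have hanti : ∀ i, Antitone fun k => (V k).1 i := fun i =>
    antitone_nat_of_succ_le fun k => subset_closure.trans (hV k i)
  -- The limit sets have order ≤ `m` everywhere, because each point lies in some `P k` and stage `k`
  -- already bounds the order there.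
  obtain ⟨G, hGo, hFG, hGU, hGord⟩ := exists_open_swelling
    (F := fun i => ⋂ k, closure ((V (k + 1)).1 i)) (U := fun i : 𝒰 => i.1) (m := m)
    (fun i => isClosed_iInter fun k => isClosed_closure) (fun i => hopen _ i.2)
    (fun i => (iInter_subset _ 0).trans (hV 0 i)) (fun x => by
      obtain ⟨k, hk⟩ := mem_iUnion.1 (hPc ▸ mem_univ x)
      refine (encard_le_encard ?_).trans (hnext k (V k) x hk)
      exact fun i hi => mem_iInter.1 hi k)
  refine ⟨range G, finite_range G, ?_, ?_, ?_, fun x => ?_⟩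
  · rintro _ ⟨i, rfl⟩; exact hGo i
  · refine eq_univ_of_forall fun x => ?_
    have h1 : ∀ k, ∃ i, x ∈ (V k).1 i := fun k => iUnion_eq_univ_iff.1 (V k).2.2 x
    choose b hb using h1
    obtain ⟨i, hi⟩ := Finite.exists_infinite_fiber b
    refine ⟨G i, ⟨i, rfl⟩, hFG i (mem_iInter.2 fun k => subset_closure ?_)⟩
    obtain ⟨l, hl, hkl⟩ := (infinite_coe_iff.1 hi).exists_gt (k + 1)
    have hl' : b l = i := hl
    have hbl := hb l
    rw [hl'] at hbl
    exact hanti i hkl.le hbl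
  · rintro _ ⟨i, rfl⟩; exact ⟨i, i.2, hGU i⟩
  · rw [← image_univ]
    refine (encard_image_filter_le (f := G) (y := x) fun _ _ h => h).trans ?_
    simpa using hGord x

/-! ### Uniform filling of small spheres -/

/-- Maps of the `k`-sphere with `a`-small image extend to maps of the ball with `b`-small image. -/
def SphereFills (Y : Type*) [MetricSpace Y] (k : ℕ) (a b : ℝ) : Prop :=
  ∀ φ : EuclideanSpace ℝ (Fin (k + 1)) → Y,
    ContinuousOn φ (Metric.sphere 0 1) →
    (∀ x ∈ Metric.sphere 0 1, ∀ y ∈ Metric.sphere 0 1, dist (φ x) (φ y) ≤ a) →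
    ∃ ψ : EuclideanSpace ℝ (Fin (k + 1)) → Y,
      ContinuousOn ψ (Metric.closedBall 0 1) ∧ EqOn ψ φ (Metric.sphere 0 1) ∧
      ∀ x ∈ Metric.closedBall 0 1, ∀ y ∈ Metric.closedBall 0 1, dist (ψ x) (ψ y) ≤ b

theorem SphereFills.anti {Y : Type*} [MetricSpace Y] {k : ℕ} {a a' b : ℝ}
    (h : SphereFills Y k a b) (ha : a' ≤ a) : SphereFills Y k a' b :=
  fun φ h1 h2 => h φ h1 fun x hx y hy => (h2 x hx y hy).trans ha

theorem IsLC.exists_sphereFills {Y : Type*} [MetricSpace Y] [CompactSpace Y] {n : ℕ}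
    (hY : IsLC n Y) {k : ℕ} (hk : k ≤ n) {b : ℝ} (hb : 0 < b) :
    ∃ a > 0, SphereFills Y k a b := by
  choose V hV hVU hfill using fun y : Y =>
    hY k hk y (Metric.ball y (b / 2)) (Metric.ball_mem_nhds y (half_pos hb))
  obtain ⟨a, ha, hleb⟩ := lebesgue_number_lemma_of_metric (isCompact_univ (X := Y))
    (c := fun y => interior (V y)) (fun y => isOpen_interior)
    (fun y _ => mem_iUnion.2 ⟨y, mem_interior_iff_mem_nhds.2 (hV y)⟩)
  refine ⟨a / 2, half_pos ha, fun φ hφ hsmall => ?_⟩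
  obtain ⟨p, hp⟩ := (NormedSpace.sphere_nonempty
    (E := EuclideanSpace ℝ (Fin (k + 1))) (x := 0) (r := 1)).2 zero_le_one
  obtain ⟨y, hy⟩ := hleb (φ p) (mem_univ _)
  obtain ⟨ψ, h1, h2, h3⟩ := hfill y φ hφ fun x hx =>
    interior_subset (hy (by
      have := hsmall x hx p hp
      rw [Metric.mem_ball]; linarith))
  exact ⟨ψ, h1, h3, fun x hx z hz => (dist_lt_of_mem_ball_half (h2 hx) (h2 hz)).le⟩

/-- The factor 3 pays for the boundary of a simplex, where two points are compared through two
vertices. -/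
theorem IsLC.exists_uniform_sphereFills {Y : Type*} [MetricSpace Y] [CompactSpace Y] {n : ℕ}
    (hY : IsLC n Y) {b : ℝ} (hb : 0 < b) :
    ∃ a > 0, a ≤ b ∧ ∀ k ≤ n, SphereFills Y k (3 * a) b := by
  have : ∀ m ≤ n + 1, ∃ a > 0, a ≤ b ∧ ∀ k < m, SphereFills Y k (3 * a) b := by
    intro m
    induction m with
    | zero => exact fun _ => ⟨b, hb, le_rfl, fun k hk => absurd hk (Nat.not_lt_zero k)⟩
    | succ m ih =>
      intro hm
      obtain ⟨a, ha, hab, h⟩ := ih (by omega)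
      obtain ⟨a', ha', h'⟩ := hY.exists_sphereFills (k := m) (by omega) hb
      refine ⟨min a (a' / 3), lt_min ha (by positivity), (min_le_left _ _).trans hab,
        fun k hk => ?_⟩
      rcases Nat.lt_succ_iff_lt_or_eq.1 hk with hk | rfl
      · exact (h k hk).anti (by linarith [min_le_left a (a' / 3)])
      · exact h'.anti (by linarith [min_le_right a (a' / 3)])
  obtain ⟨a, ha, hab, h⟩ := this (n + 1) le_rfl
  exact ⟨a, ha, hab, fun k hk => h k (by omega)⟩

/-- A sequence of tolerances allowing an extension over the successive skeleta. -/
structure IsFillingScale (Y : Type*) [MetricSpace Y] (n : ℕ) (c : ℕ → ℝ) : Prop where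
  pos : ∀ k, 0 < c k
  mono : Monotone c
  fills : ∀ k ≤ n, SphereFills Y k (3 * c k) (c (k + 1))

theorem IsLC.exists_fillingScale {Y : Type*} [MetricSpace Y] [CompactSpace Y] {n : ℕ}
    (hY : IsLC n Y) {ε : ℝ} (hε : 0 < ε) :
    ∃ c, IsFillingScale Y n c ∧ ∀ k, c k ≤ ε := by
  have : ∀ b : {b : ℝ // 0 < b}, ∃ a : {a : ℝ // 0 < a}, a ≤ b ∧
      ∀ k ≤ n, SphereFills Y k (3 * a) b := fun b => by
    obtain ⟨a, ha, h⟩ := hY.exists_uniform_sphereFills b.2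
    exact ⟨⟨a, ha⟩, h⟩
  choose ω hω hfill using this
  have hanti : Antitone fun j => ω^[j] ⟨ε, hε⟩ := antitone_nat_of_succ_le fun j => by
    rw [Function.iterate_succ_apply']
    exact hω _
  -- Tolerances are chosen downwards from `ε` at level `n + 1`; truncated subtraction keeps them
  -- equal to `ε` above that level.
  refine ⟨fun k => ω^[n + 1 - k] ⟨ε, hε⟩, ⟨fun k => Subtype.prop _, fun k l hkl => ?_,
    fun k hk => ?_⟩, fun k => hanti (Nat.zero_le _)⟩
  · exact hanti (by omega)
  · have : n + 1 - k = (n + 1 - (k + 1)) + 1 := by omega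
    simp only [this, Function.iterate_succ_apply']
    exact hfill _ k hk

/-! ### Simplices as topological balls -/

section Simplex

variable {I : Type*} [Fintype I]

/-- The face of the standard simplex spanned by the vertices in `σ`. -/
def simplexFace (σ : Finset I) : Set (I → ℝ) := {w | w ∈ stdSimplex ℝ I ∧ ∀ i ∉ σ, w i = 0}

theorem isClosed_simplexFace (σ : Finset I) : IsClosed (simplexFace σ) := by
  have : simplexFace σ = stdSimplex ℝ I ∩ ⋂ i ∈ {i | i ∉ σ}, {w | w i = 0} := by
    ext w; simp [simplexFace]
  rw [this]
  exact (isClosed_stdSimplex ℝ I).inter (isClosed_biInter fun i _ =>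
    isClosed_eq (continuous_apply i) continuous_const)

theorem single_mem_simplexFace [DecidableEq I] {σ : Finset I} {i : I} (hi : i ∈ σ) :
    Pi.single i (1 : ℝ) ∈ simplexFace σ :=
  ⟨single_mem_stdSimplex ℝ i, fun j hj => Pi.single_eq_of_ne (by rintro rfl; exact hj hi) _⟩

theorem mem_simplexFace_erase [DecidableEq I] {σ : Finset I} {w : I → ℝ} {i : I}
    (hw : w ∈ simplexFace σ) (hi : w i = 0) : w ∈ simplexFace (σ.erase i) := by
  refine ⟨hw.1, fun j hj => ?_⟩
  rcases eq_or_ne j i with rfl | hne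
  · exact hi
  · exact hw.2 j fun h => hj (Finset.mem_erase.2 ⟨hne, h⟩)

/-- A nondegenerate simplex with `k + 2` vertices is a topological `(k + 1)`-ball. -/
theorem exists_simplexFace_parametrization [DecidableEq I] {σ : Finset I} {k : ℕ}
    (hσ : σ.card = k + 2) :
    ∃ (e : (I → ℝ) → EuclideanSpace ℝ (Fin (k + 1))) (q : EuclideanSpace ℝ (Fin (k + 1)) → I → ℝ),
      Continuous e ∧ Continuous q ∧ MapsTo e (simplexFace σ) (Metric.closedBall 0 1) ∧
      MapsTo e {w ∈ simplexFace σ | ∃ i ∈ σ, w i = 0} (Metric.sphere 0 1) ∧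
      MapsTo q (Metric.sphere 0 1) {w ∈ simplexFace σ | ∃ i ∈ σ, w i = 0} ∧
      ∀ w ∈ simplexFace σ, q (e w) = w := by
  obtain ⟨i₀, hi₀⟩ : σ.Nonempty := Finset.card_pos.1 (by omega)
  have hcard : (σ.erase i₀).card = k + 1 := by rw [Finset.card_erase_of_mem hi₀]; omega
  let enum : Fin (k + 1) ≃ σ.erase i₀ := ((σ.erase i₀).equivFinOfCardEq hcard).symm
  let p : (I → ℝ) → EuclideanSpace ℝ (Fin (k + 1)) := fun w => WithLp.toLp 2 fun j => w (enum j)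
  let q : EuclideanSpace ℝ (Fin (k + 1)) → I → ℝ := fun t i =>
    if i = i₀ then 1 - ∑ j, t j else if h : i ∈ σ.erase i₀ then t (enum.symm ⟨i, h⟩) else 0
  have hp : Continuous p := by
    refine (PiLp.continuous_toLp 2 _).comp (continuous_pi fun j => continuous_apply _)
  have hq : Continuous q := by
    refine continuous_pi fun i => ?_
    by_cases h0 : i = i₀
    · simp only [q, h0, if_true]; fun_prop
    · by_cases h : i ∈ σ.erase i₀
      · simp only [q, h0, h, if_false, dif_pos]; fun_prop
      · simp only [q, h0, h, if_false, dif_neg, not_false_iff]; fun_prop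
  have hqaff : ∀ (a b : ℝ) (t u : EuclideanSpace ℝ (Fin (k + 1))), a + b = 1 → ∀ i,
      q (a • t + b • u) i = a * q t i + b * q u i := by
    intro a b t u hab i
    simp only [q]
    split_ifs
    · simp only [PiLp.add_apply, PiLp.smul_apply, smul_eq_mul, Finset.sum_add_distrib,
        ← Finset.mul_sum]
      linear_combination -hab
    · simp
    · simp
  have hsum : ∀ w : I → ℝ, (∀ i ∉ σ, w i = 0) → ∑ i, w i = w i₀ + ∑ j, w (enum j) := by
    intro w hw
    rw [← Finset.sum_subset (Finset.subset_univ σ) (fun i _ hi => hw i hi),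
      ← Finset.add_sum_erase σ w hi₀, ← Finset.sum_coe_sort (σ.erase i₀)]
    congr 1
    exact (enum.sum_comp fun x => w x).symm
  have hq_out : ∀ t, ∀ i ∉ σ, q t i = 0 := by
    intro t i hi
    have h1 : i ≠ i₀ := fun h => hi (h ▸ hi₀)
    simp [q, h1, hi]
  have hq_enum : ∀ t j, q t (enum j) = t j := by
    intro t j
    have h1 : (enum j : I) ≠ i₀ := (Finset.mem_erase.1 (enum j).2).1
    have h2 : (enum j : I) ∈ σ.erase i₀ := (enum j).2
    simp only [q, h1, if_false, h2, dif_pos, Subtype.coe_eta, Equiv.symm_apply_apply]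
  have hq_zero : ∀ t, q t i₀ = 1 - ∑ j, t j := fun t => by simp [q]
  have hq_sum : ∀ t, ∑ i, q t i = 1 := by
    intro t
    rw [hsum _ (hq_out t), hq_zero]
    simp [hq_enum]
  have hqp : ∀ w ∈ simplexFace σ, q (p w) = w := by
    intro w hw
    have hs := hsum w hw.2
    rw [hw.1.2] at hs
    ext i
    by_cases h0 : i = i₀
    · subst h0; simp only [hq_zero, p]; linarith
    · by_cases h : i ∈ σ.erase i₀
      · simp only [q, h0, if_false, h, dif_pos, p, Equiv.apply_symm_apply]
      · rw [hq_out, hw.2] <;> exact fun hi => h (Finset.mem_erase.2 ⟨h0, hi⟩)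
  -- The simplex in affine coordinates, omitting the coordinate at `i₀`: a convex body with the
  -- barycentre `t₀` in its interior.
  let T : Set (EuclideanSpace ℝ (Fin (k + 1))) := {t | ∀ i, 0 ≤ q t i}
  have hTσ : ∀ t ∈ T, q t ∈ simplexFace σ := fun t ht => ⟨⟨ht, hq_sum t⟩, hq_out t⟩
  have hpT : ∀ w ∈ simplexFace σ, p w ∈ T := fun w hw i => by
    rw [hqp w hw]; exact hw.1.1 i
  have hTconv : Convex ℝ T := by
    intro t ht u hu a b ha hb hab i
    rw [hqaff a b t u hab]
    exact add_nonneg (mul_nonneg ha (ht i)) (mul_nonneg hb (hu i))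
  have hTclosed : IsClosed T := by
    have : T = ⋂ i, {t | 0 ≤ q t i} := by ext t; simp [T]
    rw [this]
    exact isClosed_iInter fun i => isClosed_le continuous_const ((continuous_apply i).comp hq)
  have hTbdd : Bornology.IsBounded T := by
    have hc : IsCompact (p '' simplexFace σ) :=
      ((isCompact_stdSimplex ℝ I).of_isClosed_subset (isClosed_simplexFace σ)
        fun w hw => hw.1).image hp
    refine hc.isBounded.subset fun t ht => ⟨q t, hTσ t ht, ?_⟩
    ext j
    exact hq_enum t j
  have hTint : ∀ t, (∀ i ∈ σ, 0 < q t i) → t ∈ interior T := by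
    intro t ht
    have : IsOpen (⋂ i ∈ σ, {t | 0 < q t i}) := isOpen_biInter_finset fun i _ =>
      isOpen_lt continuous_const ((continuous_apply i).comp hq)
    refine mem_interior.2 ⟨_, fun u hu i => ?_, this, mem_iInter₂.2 ht⟩
    by_cases hi : i ∈ σ
    · exact (mem_iInter₂.1 hu i hi).le
    · exact (hq_out u i hi).ge
  let t₀ : EuclideanSpace ℝ (Fin (k + 1)) := WithLp.toLp 2 fun _ => 1 / (k + 2 : ℝ)
  have ht₀ : ∀ i ∈ σ, 0 < q t₀ i := by
    intro i hi
    by_cases h0 : i = i₀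
    · subst h0
      have hk : (0 : ℝ) < k + 2 := by positivity
      rw [hq_zero]
      simp only [t₀, Finset.sum_const, Finset.card_univ, Fintype.card_fin, nsmul_eq_mul]
      rw [sub_pos, mul_one_div, div_lt_one hk]
      push_cast; linarith
    · have h : i ∈ σ.erase i₀ := Finset.mem_erase.2 ⟨h0, hi⟩
      simp only [q, h0, if_false, h, dif_pos, t₀]
      positivity
  have hbd : ∀ w ∈ simplexFace σ, (∃ i ∈ σ, w i = 0) → p w ∈ frontier T := by
    rintro w hw ⟨i, hi, hwi⟩
    refine ⟨subset_closure (hpT w hw), fun hint => ?_⟩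
    -- Moving from an interior point slightly away from the barycentre stays in `T`, but makes the
    -- vanishing coordinate `i` negative.
    have hcont : Filter.Tendsto (fun s : ℝ => (1 + s) • p w + (-s) • t₀) (𝓝 0) (𝓝 (p w)) := by
      have : Continuous fun s : ℝ => (1 + s) • p w + (-s) • t₀ := by fun_prop
      simpa using this.tendsto 0
    obtain ⟨s, hsT, hs⟩ := (((hcont.eventually (mem_interior_iff_mem_nhds.1 hint)).filter_mono
      nhdsWithin_le_nhds).and (self_mem_nhdsWithin (s := Ioi (0 : ℝ)))).exists
    have h1 := hsT i
    rw [hqaff _ _ _ _ (by ring), hqp w hw, hwi] at h1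
    have h2 := mul_pos (show 0 < s from hs) (ht₀ i hi)
    linarith
  obtain ⟨e, -, he2, he3⟩ := exists_homeomorph_image_interior_closure_frontier_eq_unitBall
    hTconv ⟨t₀, hTint t₀ ht₀⟩ hTbdd
  rw [hTclosed.closure_eq] at he2
  refine ⟨fun w => e (p w), fun u => q (e.symm u), e.continuous.comp hp,
    hq.comp e.symm.continuous, fun w hw => he2 ▸ mem_image_of_mem e (hpT w hw),
    fun w hw => he3 ▸ mem_image_of_mem e (hbd w hw.1 hw.2), fun u hu => ?_, fun w hw => ?_⟩
  · rw [← he3] at hu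
    obtain ⟨t, ht, rfl⟩ := hu
    have htT : t ∈ T := hTclosed.frontier_subset ht
    simp only [Homeomorph.symm_apply_apply]
    refine ⟨hTσ t htT, ?_⟩
    by_contra! hc
    exact ht.2 (hTint t fun i hi => (htT i).lt_of_ne' (hc i hi))
  · simp only [Homeomorph.symm_apply_apply]
    exact hqp w hw

theorem SphereFills.simplexFace [DecidableEq I] {Y : Type*} [MetricSpace Y] {k : ℕ} {a b : ℝ}
    (h : SphereFills Y k a b) {σ : Finset I} (hσ : σ.card = k + 2) {φ : (I → ℝ) → Y}
    (hφ : ContinuousOn φ {w ∈ simplexFace σ | ∃ i ∈ σ, w i = 0})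
    (ha : ∀ w ∈ {w ∈ simplexFace σ | ∃ i ∈ σ, w i = 0},
      ∀ w' ∈ {w ∈ simplexFace σ | ∃ i ∈ σ, w i = 0}, dist (φ w) (φ w') ≤ a) :
    ∃ ψ : (I → ℝ) → Y, ContinuousOn ψ (simplexFace σ) ∧
      EqOn ψ φ {w ∈ simplexFace σ | ∃ i ∈ σ, w i = 0} ∧
      ∀ w ∈ simplexFace σ, ∀ w' ∈ simplexFace σ, dist (ψ w) (ψ w') ≤ b := by
  obtain ⟨e, q, he, hq, hball, hsph, hqs, hqe⟩ := exists_simplexFace_parametrization hσ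
  obtain ⟨ψ, h1, h2, h3⟩ := h (φ ∘ q) (hφ.comp hq.continuousOn hqs)
    (fun x hx y hy => ha _ (hqs hx) _ (hqs hy))
  refine ⟨ψ ∘ e, h1.comp he.continuousOn hball, fun w hw => ?_,
    fun w hw w' hw' => h3 _ (hball hw) _ (hball hw')⟩
  simp only [Function.comp, h2 (hsph hw), hqe w hw.1]

end Simplex

/-! ### Extension over skeleta -/

section Skeleton

variable {I : Type*} [Fintype I] [DecidableEq I]

theorem simplexFace_subsingleton {σ : Finset I} (hσ : σ.card ≤ 1) :
    (simplexFace σ).Subsingleton := by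
  have key : ∀ w ∈ simplexFace σ, ∀ i ∈ σ, w = Pi.single i 1 := by
    intro w hw i hi
    have h0 : ∀ j, j ≠ i → w j = 0 := fun j hj =>
      hw.2 j fun h => hj (Finset.card_le_one.1 hσ j h i hi)
    have hs := hw.1.2
    rw [Finset.sum_eq_single i (fun j _ hj => h0 j hj) (by simp)] at hs
    ext j
    rcases eq_or_ne j i with rfl | hj
    · simp [hs]
    · simp [h0 j hj, hj]
  intro w hw w' hw'
  rcases σ.eq_empty_or_nonempty with rfl | ⟨i, hi⟩
  · have := hw.1.2
    simp [hw.2] at this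
  · rw [key w hw i hi, key w' hw' i hi]

/-- Extension of a map from the vertices to the `k`-skeleton of a finite simplicial complex. -/
theorem exists_skeleton_map {Y : Type*} [MetricSpace Y] [Nonempty Y] {n : ℕ} {N : Set (Finset I)}
    (hN : ∀ σ ∈ N, ∀ τ ⊆ σ, τ.Nonempty → τ ∈ N) {v : I → Y} {c : Finset I → ℕ → ℝ}
    (hc : ∀ σ, IsFillingScale Y n (c σ)) (hmono : ∀ σ, ∀ τ ⊆ σ, ∀ k, c τ k ≤ c σ k)
    (hv : ∀ σ ∈ N, ∀ i ∈ σ, ∀ j ∈ σ, dist (v i) (v j) ≤ c σ 0) {k : ℕ} (hk : k ≤ n + 1) :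
    ∃ h : (I → ℝ) → Y, (∀ i, h (Pi.single i 1) = v i) ∧ ∀ σ ∈ N, σ.card ≤ k + 1 →
      ContinuousOn h (simplexFace σ) ∧
      ∀ w ∈ simplexFace σ, ∀ w' ∈ simplexFace σ, dist (h w) (h w') ≤ c σ k := by
  classical
  induction k with
  | zero =>
    obtain ⟨y₀⟩ := ‹Nonempty Y›
    have hinj : Function.Injective fun i : I => (Pi.single i 1 : I → ℝ) := fun i j hij => by
      by_contra hne
      have := congrFun hij i
      simp [hne] at this
    refine ⟨Function.extend (fun i : I => (Pi.single i 1 : I → ℝ)) v fun _ => y₀,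
      fun i => hinj.extend_apply _ _ i, fun σ _ hσ => ?_⟩
    have hsub := simplexFace_subsingleton hσ
    refine ⟨hsub.continuousOn _, fun w hw w' hw' => ?_⟩
    rw [hsub hw hw', dist_self]
    exact ((hc σ).pos 0).le
  | succ k ih =>
    obtain ⟨h, hvert, hh⟩ := ih (by omega)
    have hfill : ∀ σ, σ ∈ N ∧ σ.card = k + 2 → ∃ ψ : (I → ℝ) → Y, ContinuousOn ψ (simplexFace σ) ∧
        EqOn ψ h {w ∈ simplexFace σ | ∃ i ∈ σ, w i = 0} ∧
        ∀ w ∈ simplexFace σ, ∀ w' ∈ simplexFace σ, dist (ψ w) (ψ w') ≤ c σ (k + 1) := by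
      rintro σ ⟨hσ, hcard⟩
      have hface : ∀ i ∈ σ, σ.erase i ∈ N ∧ (σ.erase i).card = k + 1 := fun i hi => by
        have hce : (σ.erase i).card = k + 1 := by rw [Finset.card_erase_of_mem hi]; omega
        exact ⟨hN σ hσ _ (Finset.erase_subset _ _) (Finset.card_pos.1 (by omega)), hce⟩
      refine (((hc σ).fills k (by omega)).simplexFace hcard ?_ ?_)
      · have heq : {w ∈ simplexFace σ | ∃ i ∈ σ, w i = 0} ⊆
            ⋃ i : σ, simplexFace (σ.erase (i : I)) := by
          rintro w ⟨hw, i, hi, hwi⟩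
          exact mem_iUnion.2 ⟨⟨i, hi⟩, mem_simplexFace_erase hw hwi⟩
        refine ContinuousOn.mono ((locallyFinite_of_finite _).continuousOn_iUnion
          (fun i => isClosed_simplexFace _) fun i => ?_) heq
        exact (hh _ (hface i i.2).1 (hface i i.2).2.le).1
      · have near : ∀ w ∈ {w ∈ simplexFace σ | ∃ i ∈ σ, w i = 0}, ∃ j ∈ σ,
            dist (h w) (v j) ≤ c σ k := by
          rintro w ⟨hw, i, hi, hwi⟩
          obtain ⟨j, hj⟩ : (σ.erase i).Nonempty := Finset.card_pos.1 (by
            rw [(hface i hi).2]; omega)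
          refine ⟨j, Finset.mem_of_mem_erase hj, ?_⟩
          rw [← hvert j]
          exact ((hh _ (hface i hi).1 (hface i hi).2.le).2 w (mem_simplexFace_erase hw hwi) _
            (single_mem_simplexFace hj)).trans (hmono _ _ (Finset.erase_subset _ _) _)
        intro w hw w' hw'
        obtain ⟨j, hj, hd⟩ := near w hw
        obtain ⟨j', hj', hd'⟩ := near w' hw'
        have h1 := (hv σ hσ j hj j' hj').trans ((hc σ).mono (Nat.zero_le k))
        have h2 := dist_triangle4_right (h w) (h w') (v j) (v j')
        linarith
    choose! ψ hψc hψe hψd using hfill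
    let supp : (I → ℝ) → Finset I := fun w => Finset.univ.filter fun i => w i ≠ 0
    have hsupp : ∀ {σ w}, w ∈ simplexFace σ → supp w ⊆ σ := by
      intro σ w hw i hi
      by_contra hc
      exact (Finset.mem_filter.1 hi).2 (hw.2 i hc)
    -- The support of `w` selects the filling. On a face of smaller support `h` is kept, and there
    -- each `ψ σ` agrees with it, so the pieces fit together.
    let h' : (I → ℝ) → Y := fun w =>
      if supp w ∈ N ∧ (supp w).card = k + 2 then ψ (supp w) w else h w
    have hlow : ∀ w, (supp w).card ≠ k + 2 → h' w = h w := fun w hw =>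
      if_neg fun h => hw h.2
    refine ⟨h', fun i => ?_, fun σ hσ hcard => ?_⟩
    · rw [hlow, hvert]
      have hle : supp (Pi.single i 1) ⊆ {i} :=
        hsupp (single_mem_simplexFace (Finset.mem_singleton_self i))
      have := Finset.card_le_card hle
      rw [Finset.card_singleton] at this
      omega
    · rcases Nat.lt_or_ge σ.card (k + 2) with hlt | hge
      · have heq : EqOn h' h (simplexFace σ) := fun w hw => hlow w (by
          have := Finset.card_le_card (hsupp hw)
          omega)
        obtain ⟨h1, h2⟩ := hh σ hσ (by omega)
        refine ⟨h1.congr heq, fun w hw w' hw' => ?_⟩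
        rw [heq hw, heq hw']
        exact (h2 w hw w' hw').trans ((hc σ).mono (Nat.le_succ k))
      · have hcard' : σ.card = k + 2 := by omega
        have heq : EqOn h' (ψ σ) (simplexFace σ) := by
          intro w hw
          by_cases hs : supp w = σ
          · simp only [h', hs, hσ, hcard', and_self, if_true]
          · have hlt := Finset.card_lt_card ((hsupp hw).ssubset_of_ne hs)
            rw [hlow w (by omega)]
            obtain ⟨i, hi, hi'⟩ := Finset.exists_of_ssubset ((hsupp hw).ssubset_of_ne hs)
            refine (hψe σ ⟨hσ, hcard'⟩ ⟨hw, i, hi, ?_⟩).symm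
            simpa [supp] using hi'
        refine ⟨(hψc σ ⟨hσ, hcard'⟩).congr heq, fun w hw w' hw' => ?_⟩
        rw [heq hw, heq hw']
        exact hψd σ ⟨hσ, hcard'⟩ w hw w' hw'

end Skeleton

/-! ### Extension from closed subsets -/

/-- The new map factors through the nerve of a fine cover, of dimension at most `n + 1`. Two scales
are used: `c` keeps it near `g`, while the finer `d`, used on simplices all of whose vertices meet
`A`, keeps it near `φ` on `A`. Thus `δ` does not depend on `η`, which allows iteration. -/
theorem IsLC.exists_approximate_extension {Y : Type*} [MetricSpace Y] [CompactSpace Y] {n : ℕ}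
    (hY : IsLC n Y) {ε : ℝ} (hε : 0 < ε) :
    ∃ δ > 0, ∀ {X : Type*} [MetricSpace X] [CompactSpace X], CoveringDimLT X (n + 2) →
      ∀ {A : Set X}, IsClosed A → ∀ {φ : X → Y}, ContinuousOn φ A → ∀ g : C(X, Y),
      (∀ x ∈ A, dist (g x) (φ x) < δ) → ∀ η > 0,
      ∃ g' : C(X, Y), (∀ x, dist (g' x) (g x) ≤ ε) ∧ ∀ x ∈ A, dist (g' x) (φ x) < η := by
  classical
  obtain ⟨c, hc, hcε⟩ := hY.exists_fillingScale (half_pos hε)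
  refine ⟨c 0 / 4, by linarith [hc.pos 0], ?_⟩
  intro X _ _ hX A hA φ hφ g hg η hη
  rcases isEmpty_or_nonempty X with hXe | ⟨⟨x₀⟩⟩
  · exact ⟨g, fun x => isEmptyElim x, fun x => isEmptyElim x⟩
  have : Nonempty Y := ⟨g x₀⟩
  -- The bound `c 0` puts all of `d` below all of `c`, so tolerances grow from faces to simplices;
  -- `η / 2` leaves room for two errors.
  obtain ⟨d, hd, hdη⟩ := hY.exists_fillingScale (lt_min (hc.pos 0) (half_pos hη))
  obtain ⟨r₁, hr₁, hgr⟩ := Metric.uniformContinuous_iff.1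
    (CompactSpace.uniformContinuous_of_continuous g.continuous) (c 0 / 4)
    (by linarith [hc.pos 0])
  obtain ⟨r₂, hr₂, hφr⟩ := Metric.uniformContinuousOn_iff.1
    (hA.isCompact.uniformContinuousOn_of_continuous hφ) (d 0) (hd.pos 0)
  obtain ⟨𝒱, hfin, hV, hcov, hord⟩ :=
    hX.hasSmallCover_univ (lt_min hr₁ (half_pos hr₂))
  have : Fintype 𝒱 := hfin.fintype
  obtain ⟨p, hp⟩ := PartitionOfUnity.exists_isSubordinate (isClosed_univ (X := X))
    (fun i : 𝒱 => i.1) (fun i => (hV i i.2).1) (by rwa [← sUnion_eq_iUnion])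
  have hpmem : ∀ {x : X} {i : 𝒱}, p i x ≠ 0 → x ∈ i.1 := fun {x i} h =>
    hp i (subset_tsupport _ h)
  let l : X → 𝒱 → ℝ := fun x i => p i x
  have hlcont : Continuous l := continuous_pi fun i => (p i).continuous
  have hlmem : ∀ x, l x ∈ stdSimplex ℝ 𝒱 := fun x =>
    ⟨fun i => p.nonneg i x, by rw [← finsum_eq_sum_of_fintype]; exact p.sum_eq_one (mem_univ x)⟩
  let N : Set (Finset 𝒱) := {σ | σ.Nonempty ∧ ∃ x, ∀ i ∈ σ, x ∈ i.1}
  have hNcard : ∀ σ ∈ N, σ.card ≤ n + 2 := by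
    rintro σ ⟨-, x, hx⟩
    have h1 : (Subtype.val '' (σ : Set 𝒱)).encard ≤ ((n + 2 : ℕ) : ℕ∞) := by
      refine (encard_le_encard ?_).trans (hord x)
      rintro _ ⟨i, hi, rfl⟩
      exact ⟨i.2, hx i hi⟩
    rw [Subtype.val_injective.encard_image, encard_coe_eq_coe_finsetCard] at h1
    exact_mod_cast h1
  -- A vertex goes to a value of `φ` if its cover element meets `A`, and otherwise to a value of
  -- `g`. Two errors of `c 0 / 4` place it within `c 0 / 2` of `g`, hence adjacent vertices within
  -- `c 0`.
  have hvex : ∀ i : 𝒱, ∃ y : Y, ((i.1 ∩ A).Nonempty → ∃ a ∈ i.1 ∩ A, y = φ a) ∧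
      ∀ x ∈ i.1, dist y (g x) < c 0 / 2 := by
    intro i
    by_cases hiA : (i.1 ∩ A).Nonempty
    · obtain ⟨a, ha⟩ := hiA
      refine ⟨φ a, fun _ => ⟨a, ha, rfl⟩, fun x hx => ?_⟩
      have h1 := hg a ha.2
      have h2 := hgr (((hV i i.2).2 a ha.1 x hx).trans_le (min_le_left _ _))
      have h3 := dist_triangle_left (φ a) (g x) (g a)
      linarith
    · by_cases hi : i.1.Nonempty
      · obtain ⟨a, ha⟩ := hi
        refine ⟨g a, fun h => absurd h hiA, fun x hx => ?_⟩
        have h2 := hgr (((hV i i.2).2 a ha x hx).trans_le (min_le_left _ _))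
        linarith [hc.pos 0]
      · exact ⟨g x₀, fun h => absurd h hiA, fun x hx => absurd ⟨x, hx⟩ hi⟩
  choose v hvA hvg using hvex
  have hdc : ∀ k, d k ≤ c k := fun k =>
    ((hdη k).trans (min_le_left _ _)).trans (hc.mono (Nat.zero_le k))
  let s : Finset 𝒱 → ℕ → ℝ := fun σ => if ∀ i ∈ σ, (i.1 ∩ A).Nonempty then d else c
  have hs : ∀ σ, IsFillingScale Y n (s σ) := fun σ => by
    simp only [s]; split_ifs
    exacts [hd, hc]
  have hsc : ∀ σ k, s σ k ≤ c k := fun σ k => by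
    simp only [s]; split_ifs
    exacts [hdc k, le_rfl]
  obtain ⟨h, hvert, hh⟩ := exists_skeleton_map (N := N) (v := v) (c := s) (n := n)
    (fun σ hσ τ hτ hne => ⟨hne, hσ.2.imp fun x hx i hi => hx i (hτ hi)⟩) hs
    (fun σ τ hτ k => by
      by_cases hσ : ∀ i ∈ σ, (i.1 ∩ A).Nonempty
      · have hτ' : ∀ i ∈ τ, (i.1 ∩ A).Nonempty := fun i hi => hσ i (hτ hi)
        simp only [s, if_pos hσ, if_pos hτ', le_rfl]
      · simp only [s, if_neg hσ]
        exact hsc τ k)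
    (fun σ hσ i hi j hj => by
      obtain ⟨-, x, hx⟩ := hσ
      by_cases hσA : ∀ i ∈ σ, (i.1 ∩ A).Nonempty
      · simp only [s, if_pos hσA]
        obtain ⟨a, ha, hva⟩ := hvA i (hσA i hi)
        obtain ⟨b, hb, hvb⟩ := hvA j (hσA j hj)
        rw [hva, hvb]
        refine (hφr a ha.2 b hb.2 ?_).le
        have h1 := ((hV i i.2).2 a ha.1 x (hx i hi)).trans_le (min_le_right _ _)
        have h2 := ((hV j j.2).2 x (hx j hj) b hb.1).trans_le (min_le_right _ _)
        linarith [dist_triangle a x b]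
      · simp only [s, if_neg hσA]
        have h1 := hvg i x (hx i hi)
        have h2 := hvg j x (hx j hj)
        linarith [dist_triangle_right (v i) (v j) (g x)])
    (k := n + 1) le_rfl
  have hhN : ∀ σ ∈ N, _ := fun σ hσ => hh σ hσ (hNcard σ hσ)
  let supp : X → Finset 𝒱 := fun x => Finset.univ.filter fun i => l x i ≠ 0
  have hsupp_mem : ∀ {x i}, i ∈ supp x → x ∈ i.1 := fun {x i} hi =>
    hpmem (Finset.mem_filter.1 hi).2
  have hface : ∀ x, l x ∈ simplexFace (supp x) := fun x => ⟨hlmem x, fun i hi => by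
    by_contra hne
    exact hi (Finset.mem_filter.2 ⟨Finset.mem_univ i, hne⟩)⟩
  have hsupp_ne : ∀ x, (supp x).Nonempty := fun x => by
    by_contra hne
    have h1 := (hlmem x).2
    have h2 := (hface x).2
    rw [Finset.not_nonempty_iff_eq_empty.1 hne] at h2
    simp [h2] at h1
  have hsuppN : ∀ x, supp x ∈ N := fun x => ⟨hsupp_ne x, x, fun i hi => hsupp_mem hi⟩
  have hcont : Continuous fun x => h (l x) := by
    refine (locallyFinite_of_finite fun σ : N => l ⁻¹' simplexFace σ.1).continuous
      (eq_univ_of_forall fun x => mem_iUnion.2 ⟨⟨supp x, hsuppN x⟩, hface x⟩)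
      (fun σ => (isClosed_simplexFace σ.1).preimage hlcont) fun σ => ?_
    exact (hhN σ.1 σ.2).1.comp hlcont.continuousOn fun x hx => hx
  have hnear : ∀ x, ∃ i, x ∈ i.1 ∧ dist (h (l x)) (v i) ≤ s (supp x) (n + 1) := fun x => by
    obtain ⟨i, hi⟩ := hsupp_ne x
    refine ⟨i, hsupp_mem hi, ?_⟩
    rw [← hvert i]
    exact (hhN _ (hsuppN x)).2 _ (hface x) _ (single_mem_simplexFace hi)
  refine ⟨⟨fun x => h (l x), hcont⟩, fun x => ?_, fun x hxA => ?_⟩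
  · obtain ⟨i, hi, hd⟩ := hnear x
    have h1 := hd.trans ((hsc _ _).trans (hcε _))
    have h2 := hvg i x hi
    have h3 := dist_triangle (h (l x)) (v i) (g x)
    have h4 := hcε 0
    simp only [ContinuousMap.coe_mk]
    linarith [hc.pos 0]
  · obtain ⟨i, hi, hdi⟩ := hnear x
    have hall : ∀ j ∈ supp x, (j.1 ∩ A).Nonempty := fun j hj => ⟨x, hsupp_mem hj, hxA⟩
    simp only [s, if_pos hall] at hdi
    obtain ⟨a, ha, hva⟩ := hvA i ⟨x, hi, hxA⟩
    have h1 := hφr a ha.2 x hxA (((hV i i.2).2 a ha.1 x hi).trans_le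
      ((min_le_right _ _).trans (half_le_self hr₂.le)))
    rw [← hva] at h1
    have h2 := dist_triangle (h (l x)) (v i) (φ x)
    have h3 := (hdη (n + 1)).trans (min_le_right _ _)
    have h4 := (hdη 0).trans (min_le_right _ _)
    simp only [ContinuousMap.coe_mk]
    linarith

/-- Controlled extension of maps from closed subsets of an `(n + 1)`-dimensional compactum. -/
theorem IsLC.exists_controlled_extension {Y : Type*} [MetricSpace Y] [CompactSpace Y] {n : ℕ}
    (hY : IsLC n Y) {ε : ℝ} (hε : 0 < ε) :
    ∃ δ > 0, ∀ {X : Type*} [MetricSpace X] [CompactSpace X], CoveringDimLT X (n + 2) →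
      ∀ {A : Set X}, IsClosed A → ∀ {φ : X → Y}, ContinuousOn φ A → ∀ g : C(X, Y),
      (∀ x ∈ A, dist (g x) (φ x) < δ) →
      ∃ g' : C(X, Y), (∀ x, dist (g' x) (g x) ≤ ε) ∧ ∀ x ∈ A, g' x = φ x := by
  have hpos : ∀ k : ℕ, 0 < ε / 2 / 2 ^ k := fun k => by positivity
  choose δ hδ hext using fun k => hY.exists_approximate_extension (hpos k)
  refine ⟨δ 0, hδ 0, ?_⟩
  intro X _ _ hX A hA φ hφ g hg
  -- The bound `δ k` permits the next correction, and `1 / (k + 1)` forces convergence to `φ` on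
  -- `A`. The corrections `ε / 2 / 2 ^ k` sum to `ε`.
  let η : ℕ → ℝ := fun k => min (δ k) (1 / (k + 1))
  have hη : ∀ k, 0 < η k := fun k => lt_min (hδ k) Nat.one_div_pos_of_nat
  let S : ℕ → Type _ := fun k => {f : C(X, Y) // ∀ x ∈ A, dist (f x) (φ x) < δ k}
  have step : ∀ k (f : S k), ∃ f' : S (k + 1), (∀ x, dist (f'.1 x) (f.1 x) ≤ ε / 2 / 2 ^ k) ∧
      ∀ x ∈ A, dist (f'.1 x) (φ x) < 1 / ((k + 1 : ℕ) + 1) := by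
    intro k f
    obtain ⟨f', h1, h2⟩ := hext k hX hA hφ f.1 f.2 (η (k + 1)) (hη (k + 1))
    exact ⟨⟨f', fun x hx => (h2 x hx).trans_le (min_le_left _ _)⟩, h1,
      fun x hx => (h2 x hx).trans_le (min_le_right _ _)⟩
  choose next hnext hnextA using step
  let f : ∀ k, S k := fun k => Nat.rec ⟨g, hg⟩ next k
  have hdist : ∀ k, dist (f k).1 (f (k + 1)).1 ≤ ε / 2 / 2 ^ k := fun k =>
    (ContinuousMap.dist_le (hpos k).le).2 fun x => by
      rw [dist_comm]; exact hnext k (f k) x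
  obtain ⟨g', hg'⟩ := cauchySeq_tendsto_of_complete (cauchySeq_of_le_geometric_two hdist)
  refine ⟨g', fun x => ?_, fun x hx => ?_⟩
  · have h1 := dist_le_of_le_geometric_two_of_tendsto₀ hdist hg'
    rw [dist_comm]
    exact (ContinuousMap.dist_apply_le_dist x).trans h1
  · have h1 : Filter.Tendsto (fun k => (f (k + 1)).1 x) Filter.atTop (𝓝 (g' x)) :=
      ((ContinuousEvalConst.continuous_eval_const x).tendsto g').comp
        (hg'.comp (Filter.tendsto_add_atTop_nat 1))
    have h2 : Filter.Tendsto (fun k => (f (k + 1)).1 x) Filter.atTop (𝓝 (φ x)) := by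
      rw [tendsto_iff_dist_tendsto_zero]
      refine squeeze_zero (fun _ => dist_nonneg) (fun k => (hnextA k (f k) x hx).le) ?_
      exact tendsto_one_div_add_atTop_nhds_zero_nat.comp (Filter.tendsto_add_atTop_nat 1)
    exact tendsto_nhds_unique h1 h2

/-! ### Unseparated points and the Lelek set -/

/-- Points that no small open set separates from the rest of their fibre. -/
def unseparatedSet {X Y : Type*} [MetricSpace X] (f : X → Y) (ε : ℝ) : Set X :=
  {x | ∀ O : Set X, IsOpen O → x ∈ O → (∀ y ∈ O, ∀ z ∈ O, dist y z < ε) →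
    ∃ z ∈ frontier O, f z = f x}

section Unseparated

variable {X Y : Type*} [MetricSpace X] [CompactSpace X] [MetricSpace Y]

/-- One witness `O` serves all nearby pairs: its frontier is compact, so `f z ≠ f x` there survives
small changes of both `f` and `x`. -/
theorem eventually_notMem_unseparatedSet {ε : ℝ} {f : C(X, Y)} {x : X}
    (h : x ∉ unseparatedSet f ε) :
    ∀ᶠ q : C(X, Y) × X in 𝓝 (f, x), q.2 ∉ unseparatedSet q.1 ε := by
  simp only [unseparatedSet, mem_ofPred_eq, not_forall, not_exists, not_and] at h
  obtain ⟨O, hO, hx, hsmall, hne⟩ := h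
  have h1 : ∀ᶠ q : C(X, Y) × X in 𝓝 (f, x), ∀ z ∈ frontier O, q.1 z ≠ q.1 q.2 := by
    refine isClosed_frontier.isCompact.eventually_forall_of_forall_eventually fun z hz => ?_
    have hopen : IsOpen {q : (C(X, Y) × X) × X | q.1.1 q.2 ≠ q.1.1 q.1.2} := by
      refine isOpen_ne_fun ?_ ?_ <;> fun_prop
    exact hopen.mem_nhds (hne z hz)
  have h2 : ∀ᶠ q : C(X, Y) × X in 𝓝 (f, x), q.2 ∈ O :=
    (continuous_snd.tendsto (f, x)).eventually (hO.mem_nhds hx)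
  filter_upwards [h1, h2] with q hq1 hq2 hmem
  obtain ⟨z, hz, hzq⟩ := hmem O hO hq2 hsmall
  exact hq1 z hz hzq

theorem isClosed_unseparatedSet (f : C(X, Y)) (ε : ℝ) : IsClosed (unseparatedSet f ε) := by
  rw [← isOpen_compl_iff, isOpen_iff_eventually]
  intro x hx
  have hc : Continuous fun x : X => (f, x) := by fun_prop
  exact (hc.tendsto x).eventually (eventually_notMem_unseparatedSet hx)

theorem isOpen_setOf_unseparatedSet_subset {G : Set X} (hG : IsOpen G) (ε : ℝ) :
    IsOpen {f : C(X, Y) | unseparatedSet f ε ⊆ G} := by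
  rw [isOpen_iff_eventually]
  intro f hf
  have h1 : ∀ᶠ g : C(X, Y) in 𝓝 f, ∀ x ∈ Gᶜ, x ∉ unseparatedSet g ε :=
    hG.isClosed_compl.isCompact.eventually_forall_of_forall_eventually fun x hx =>
      eventually_notMem_unseparatedSet fun h => hx (hf h)
  filter_upwards [h1] with g hg x hx
  by_contra hc
  exact hg x hc hx

theorem IsPreconnected.inter_frontier_nonempty_of_mem {X : Type*} [TopologicalSpace X]
    {B O : Set X} (hB : IsPreconnected B) (hO : IsOpen O) {x z : X} (hx : x ∈ B) (hxO : x ∈ O)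
    (hz : z ∈ B) (hzO : z ∉ O) : (B ∩ frontier O).Nonempty := by
  by_contra hc
  have hdis : ∀ y ∈ B, y ∉ frontier O := fun y hy hyf => hc ⟨y, hy, hyf⟩
  rw [hO.frontier_eq] at hdis
  obtain ⟨y, -, hy1, hy2⟩ := hB O (closure O)ᶜ hO isClosed_closure.isOpen_compl
    (fun y hy => by
      by_cases hyO : y ∈ O
      · exact Or.inl hyO
      · exact Or.inr fun h => hdis y hy ⟨h, hyO⟩)
    ⟨x, hx, hxO⟩ ⟨z, hz, fun h => hdis z hz ⟨h, hzO⟩⟩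
  exact hy2 (subset_closure hy1)

theorem exists_isClopen_subset_of_connectedComponent_subset {Z : Type*} [TopologicalSpace Z]
    [T2Space Z] [CompactSpace Z] {x : Z} {U : Set Z} (hU : IsOpen U)
    (h : connectedComponent x ⊆ U) : ∃ W, IsClopen W ∧ x ∈ W ∧ W ⊆ U := by
  rw [connectedComponent_eq_iInter_isClopen] at h
  have : Nonempty {s : Set Z // IsClopen s ∧ x ∈ s} := ⟨⟨univ, isClopen_univ, mem_univ x⟩⟩
  obtain ⟨W, hW⟩ := exists_subset_nhds_of_compactSpace
    (V := fun s : {s : Set Z // IsClopen s ∧ x ∈ s} => s.1)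
    (fun s t => ⟨⟨s.1 ∩ t.1, s.2.1.inter t.2.1, s.2.2, t.2.2⟩, inter_subset_left,
      inter_subset_right⟩) (fun s => s.2.1.isClosed)
    (fun y hy => hU.mem_nhds (h hy))
  exact ⟨W.1, W.2.1, W.2.2, hW⟩

/-- Were the component a point, a relatively clopen piece `W` of the fibre would contain `x` and lie
in a small ball. A small open set around `W` whose closure avoids the rest of the fibre has frontier
disjoint from the fibre. -/
theorem nontrivial_connectedComponentIn_of_mem_unseparatedSet {f : C(X, Y)} {ε : ℝ} (hε : 0 < ε)
    {x : X} (hx : x ∈ unseparatedSet f ε) :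
    (connectedComponentIn (f ⁻¹' {f x}) x).Nontrivial := by
  by_contra hc
  rw [not_nontrivial_iff] at hc
  have hxZ : x ∈ f ⁻¹' {f x} := rfl
  have hZ : IsClosed (f ⁻¹' {f x}) := isClosed_singleton.preimage f.continuous
  have : CompactSpace (f ⁻¹' {f x}) := isCompact_iff_compactSpace.1 hZ.isCompact
  obtain ⟨W, hW, hxW, hWb⟩ := exists_isClopen_subset_of_connectedComponent_subset
    (x := (⟨x, hxZ⟩ : f ⁻¹' {f x})) (U := (↑) ⁻¹' Metric.ball x (ε / 2))
    (Metric.isOpen_ball.preimage continuous_subtype_val) (fun y hy => by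
      have h1 : (y : X) ∈ connectedComponentIn (f ⁻¹' {f x}) x := by
        rw [connectedComponentIn_eq_image hxZ]
        exact ⟨y, hy, rfl⟩
      have h2 := hc h1 (mem_connectedComponentIn hxZ)
      rw [mem_preimage, h2]
      exact Metric.mem_ball_self (half_pos hε))
  have hWc : IsClosed ((↑) '' W : Set X) := hZ.isClosedEmbedding_subtypeVal.isClosedMap _ hW.1
  have hWc' : IsClosed ((↑) '' Wᶜ : Set X) :=
    hZ.isClosedEmbedding_subtypeVal.isClosedMap _ hW.compl.1
  obtain ⟨O, hO, hWO, hOc⟩ := normal_exists_closure_subset hWc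
    (Metric.isOpen_ball.inter hWc'.isOpen_compl) (t := Metric.ball x (ε / 2) ∩ ((↑) '' Wᶜ)ᶜ) (by
      rintro _ ⟨y, hy, rfl⟩
      refine ⟨hWb hy, ?_⟩
      rintro ⟨z, hz, hzy⟩
      exact hz (Subtype.ext hzy ▸ hy))
  obtain ⟨z, hz, hzx⟩ := hx O hO (hWO ⟨_, hxW, rfl⟩) fun y hy z hz =>
    dist_lt_of_mem_ball_half (hOc (subset_closure hy)).1 (hOc (subset_closure hz)).1
  rw [hO.frontier_eq] at hz
  by_cases hzW : (⟨z, hzx⟩ : f ⁻¹' {f x}) ∈ W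
  · exact hz.2 (hWO ⟨_, hzW, rfl⟩)
  · exact (hOc hz.1).2 ⟨_, hzW, rfl⟩

/-- A nondegenerate component through `x` contains a point at some positive distance from `x`, so it
must cross the frontier of any smaller open set around `x`. -/
theorem lelekSet_eq_iUnion_unseparatedSet (f : C(X, Y)) :
    lelekSet f = ⋃ k : ℕ, unseparatedSet f (1 / (k + 1)) := by
  ext x
  constructor
  · rintro ⟨B, ⟨y, x₀, hx₀, rfl, hB⟩, hx⟩
    obtain ⟨z, hz, hzx⟩ := hB.exists_ne x
    obtain ⟨k, hk⟩ := exists_nat_one_div_lt (dist_pos.2 hzx)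
    refine mem_iUnion.2 ⟨k, fun O hO hxO hsmall => ?_⟩
    obtain ⟨w, hwB, hwO⟩ := isPreconnected_connectedComponentIn.inter_frontier_nonempty_of_mem
      hO hx hxO hz fun hzO => absurd (hsmall z hzO x hxO) (not_lt.2 hk.le)
    have hsub := connectedComponentIn_subset (f ⁻¹' {y}) x₀
    exact ⟨w, hwO, (hsub hwB : f w = y).trans (hsub hx : f x = y).symm⟩
  · intro hx
    obtain ⟨k, hk⟩ := mem_iUnion.1 hx
    exact ⟨_, ⟨f x, x, rfl, rfl,
      nontrivial_connectedComponentIn_of_mem_unseparatedSet Nat.one_div_pos_of_nat hk⟩,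
      mem_connectedComponentIn rfl⟩

theorem isOpen_setOf_hasSmallCover_unseparatedSet (ε δ : ℝ) (m : ℕ) :
    IsOpen {f : C(X, Y) | HasSmallCover (unseparatedSet f ε) δ m} := by
  rw [isOpen_iff_mem_nhds]
  rintro f ⟨𝒱, h1, h2, h3, h4⟩
  filter_upwards [(isOpen_setOf_unseparatedSet_subset
    (isOpen_sUnion fun V hV => (h2 V hV).1) ε).mem_nhds h3] with g hg
  exact ⟨𝒱, h1, h2, hg, h4⟩

/-- The Lelek set need not be compact, but it is a countable union of compact unseparated sets, so
the sum theorem reduces its dimension to countably many conditions, each open in `f`. -/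
theorem coveringDim_lelekSet_le_iff (f : C(X, Y)) (n : ℕ) :
    coveringDim (lelekSet f) ≤ n ↔
      ∀ k j : ℕ, HasSmallCover (unseparatedSet f (1 / (k + 1))) (1 / (j + 1)) (n + 1) := by
  have hsub : ∀ k : ℕ, unseparatedSet f (1 / (k + 1)) ⊆ lelekSet f := fun k => by
    rw [lelekSet_eq_iUnion_unseparatedSet]
    exact subset_iUnion (fun k : ℕ => unseparatedSet f (1 / (k + 1))) k
  rw [coveringDim_le_iff]
  constructor
  · exact fun h k j => (h.hasSmallCover Nat.one_div_pos_of_nat).mono (hsub k)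
  · intro h
    refine coveringDimLT_of_iUnion_compact
      (P := fun k : ℕ => ((↑) ⁻¹' unseparatedSet f (1 / (k + 1)) : Set (lelekSet f)))
      (fun k => ?_) ?_ fun k δ hδ => ?_
    · rw [Subtype.isCompact_iff, Subtype.image_preimage_coe, inter_eq_right.2 (hsub k)]
      exact (isClosed_unseparatedSet f _).isCompact
    · rw [← preimage_iUnion, ← lelekSet_eq_iUnion_unseparatedSet, Subtype.coe_preimage_self]
    · obtain ⟨j, hj⟩ := exists_nat_one_div_lt hδ
      obtain ⟨𝒱, h1, h2, h3, h4⟩ := (h k j).preimage_val (F := lelekSet f)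
      exact ⟨𝒱, h1, fun V hV => ⟨(h2 V hV).1, fun x hx y hy => ((h2 V hV).2 x hx y hy).trans hj⟩,
        h3, h4⟩

end Unseparated

/-! ### Density and the conclusion -/

theorem exists_ne_dist_lt {Y : Type*} [MetricSpace Y] [ConnectedSpace Y] [Nontrivial Y] (y : Y)
    {δ : ℝ} (hδ : 0 < δ) : ∃ z, z ≠ y ∧ dist z y < δ := by
  obtain ⟨z, hz⟩ := ((eventually_mem_nhdsWithin (a := y) (s := {y}ᶜ)).and
    (mem_nhdsWithin_of_mem_nhds (Metric.ball_mem_nhds y hδ))).exists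
  exact ⟨z, hz⟩

theorem dense_setOf_hasSmallCover_unseparatedSet {X Y : Type*} [MetricSpace X] [CompactSpace X]
    [MetricSpace Y] [CompactSpace Y] [ConnectedSpace Y] [Nontrivial Y] {n : ℕ}
    (hX : CoveringDimLT X (n + 2)) (hY : IsLC n Y) {ε δ : ℝ} (hε : 0 < ε) (hδ : 0 < δ) :
    Dense {f : C(X, Y) | HasSmallCover (unseparatedSet f ε) δ (n + 1)} := by
  classical
  refine Metric.dense_iff.2 fun f₀ r hr => ?_
  obtain ⟨δ₀, hδ₀, hext⟩ := hY.exists_controlled_extension (half_pos hr)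
  obtain ⟨r₁, hr₁, hf₀⟩ := Metric.uniformContinuous_iff.1
    (CompactSpace.uniformContinuous_of_continuous f₀.continuous) (δ₀ / 2) (half_pos hδ₀)
  obtain ⟨𝒱, hfin, hV, hcov, hord⟩ := hX.hasSmallCover_univ (lt_min hr₁ (lt_min hε hδ))
  have : Fintype 𝒱 := hfin.fintype
  obtain ⟨G, hGcov, hGo, hGV⟩ := exists_iUnion_eq_closure_subset (u := fun i : 𝒱 => i.1)
    (fun i => (hV i i.2).1) (fun x => toFinite _)
    (by rw [← sUnion_eq_iUnion]; exact univ_subset_iff.1 hcov)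
  let S : Type _ := {σ : Finset 𝒱 // σ.card = n + 2}
  let K : S → Set X := fun σ => ⋂ i ∈ σ.1, closure (G i)
  let W : S → Set X := fun σ => ⋂ i ∈ σ.1, i.1
  have hKc : ∀ σ, IsClosed (K σ) := fun σ => isClosed_biInter fun i _ => isClosed_closure
  have hWo : ∀ σ, IsOpen (W σ) := fun σ => isOpen_biInter_finset fun i _ => (hV i i.2).1
  have hKW : ∀ σ, K σ ⊆ W σ := fun σ => iInter₂_mono fun i _ => hGV i
  have hWsmall : ∀ σ, ∀ x ∈ W σ, ∀ y ∈ W σ, dist x y < min r₁ (min ε δ) := by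
    intro σ x hx y hy
    obtain ⟨i, hi⟩ : σ.1.Nonempty := Finset.card_pos.1 (by rw [σ.2]; omega)
    exact (hV i i.2).2 x (mem_iInter₂.1 hx i hi) y (mem_iInter₂.1 hy i hi)
  -- A common point lies in every member indexed by `σ ∪ τ`; order ≤ `n + 2` then forces `σ = τ`.
  have hWdisj : ∀ {σ τ x}, x ∈ W σ → x ∈ W τ → σ = τ := by
    intro σ τ x hσ hτ
    have h1 : (Subtype.val '' ((σ.1 ∪ τ.1 : Finset 𝒱) : Set 𝒱)).encard ≤ ((n + 2 : ℕ) : ℕ∞) := by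
      refine (encard_le_encard ?_).trans (hord x)
      rintro _ ⟨i, hi, rfl⟩
      rcases Finset.mem_union.1 hi with h | h
      · exact ⟨i.2, mem_iInter₂.1 hσ i h⟩
      · exact ⟨i.2, mem_iInter₂.1 hτ i h⟩
    rw [Subtype.val_injective.encard_image, encard_coe_eq_coe_finsetCard] at h1
    have h2 : (σ.1 ∪ τ.1).card ≤ n + 2 := by exact_mod_cast h1
    have h3 := Finset.eq_of_subset_of_card_le (Finset.subset_union_left (s₁ := σ.1) (s₂ := τ.1))
      (by rw [σ.2]; exact h2)
    have h4 := Finset.eq_of_subset_of_card_le (Finset.subset_union_right (s₁ := σ.1) (s₂ := τ.1))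
      (by rw [τ.2]; exact h2)
    exact Subtype.ext (h3.trans h4.symm)
  choose O hOo hKO hOW using fun σ => normal_exists_closure_subset (hKc σ) (hWo σ) (hKW σ)
  have hvals : ∀ σ, ∃ c c' : Y, c ≠ c' ∧ ∀ x ∈ W σ, dist (f₀ x) c < δ₀ ∧ dist (f₀ x) c' < δ₀ := by
    intro σ
    by_cases hne : (W σ).Nonempty
    · obtain ⟨x₀, hx₀⟩ := hne
      obtain ⟨c', hne', hc'⟩ := exists_ne_dist_lt (f₀ x₀) (half_pos hδ₀)
      refine ⟨f₀ x₀, c', hne'.symm, fun x hx => ?_⟩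
      have h1 := hf₀ ((hWsmall σ x hx x₀ hx₀).trans_le (min_le_left _ _))
      have h2 := dist_triangle_right (f₀ x) c' (f₀ x₀)
      exact ⟨by linarith, by linarith⟩
    · obtain ⟨c, c', hcc⟩ := exists_pair_ne Y
      exact ⟨c, c', hcc, fun x hx => absurd ⟨x, hx⟩ hne⟩
  choose c c' hcc hcd using hvals
  -- Only the values on the sets `K σ` and the frontiers of the `O σ` matter: by disjointness of the
  -- `W σ`, `φ` is constant on each of these finitely many closed sets, hence continuous on their
  -- union.
  let φ : X → Y := fun x => if h : ∃ σ, x ∈ W σ then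
    if x ∈ O h.choose then c' h.choose else c h.choose else f₀ x
  have hφ : ∀ σ, ∀ x ∈ W σ, φ x = if x ∈ O σ then c' σ else c σ := by
    intro σ x hx
    have h : ∃ σ, x ∈ W σ := ⟨σ, hx⟩
    have hch : h.choose = σ := hWdisj h.choose_spec hx
    simp only [φ, dif_pos h, hch]
  have hφK : ∀ σ, EqOn φ (fun _ => c' σ) (K σ) := fun σ x hx => by
    rw [hφ σ x (hKW σ hx), if_pos (hKO σ hx)]
  have hFW : ∀ σ, frontier (O σ) ⊆ W σ := fun σ => frontier_subset_closure.trans (hOW σ)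
  have hφF : ∀ σ, EqOn φ (fun _ => c σ) (frontier (O σ)) := fun σ x hx => by
    rw [hφ σ x (hFW σ hx), if_neg ((hOo σ).frontier_eq ▸ hx).2]
  let A : S ⊕ S → Set X := Sum.elim K fun σ => frontier (O σ)
  have hAc : ∀ s, IsClosed (A s) := by
    rintro (σ | σ)
    exacts [hKc σ, isClosed_frontier]
  have hφA : ContinuousOn φ (⋃ s, A s) := by
    refine (locallyFinite_of_finite A).continuousOn_iUnion hAc ?_
    rintro (σ | σ)
    exacts [continuousOn_const.congr (hφK σ), continuousOn_const.congr (hφF σ)]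
  obtain ⟨g, hgf, hgφ⟩ := hext hX (isClosed_iUnion_of_finite hAc) hφA f₀ (by
    intro x hx
    obtain ⟨σ | σ, hxA⟩ := mem_iUnion.1 hx
    · rw [hφK σ hxA]
      exact (hcd σ x (hKW σ hxA)).2
    · rw [hφF σ hxA]
      exact (hcd σ x (hFW σ hxA)).1)
  have hgK : ∀ σ, ∀ x ∈ K σ, g x = c' σ := fun σ x hx =>
    (hgφ x (mem_iUnion.2 ⟨Sum.inl σ, hx⟩)).trans (hφK σ hx)
  have hgF : ∀ σ, ∀ x ∈ frontier (O σ), g x = c σ := fun σ x hx =>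
    (hgφ x (mem_iUnion.2 ⟨Sum.inr σ, hx⟩)).trans (hφF σ hx)
  have hsep : ∀ σ, ∀ x ∈ K σ, x ∉ unseparatedSet g ε := by
    intro σ x hx hmem
    have hOsub : O σ ⊆ W σ := subset_closure.trans (hOW σ)
    obtain ⟨z, hz, hzx⟩ := hmem (O σ) (hOo σ) (hKO σ hx) fun y hy z hz =>
      (hWsmall σ y (hOsub hy) z (hOsub hz)).trans_le ((min_le_right _ _).trans (min_le_left _ _))
    exact hcc σ (by rw [← hgF σ z hz, hzx, hgK σ x hx])
  refine ⟨g, ?_, range fun i => G i \ ⋃ σ, K σ, finite_range _, ?_, ?_, fun x => ?_⟩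
  · rw [Metric.mem_ball]
    exact ((ContinuousMap.dist_le (half_pos hr).le).2 hgf).trans_lt (half_lt_self hr)
  · rintro _ ⟨i, rfl⟩
    have hGi : G i ⊆ i.1 := subset_closure.trans (hGV i)
    exact ⟨(hGo i).sdiff (isClosed_iUnion_of_finite hKc), fun x hx y hy =>
      ((hV i i.2).2 x (hGi hx.1) y (hGi hy.1)).trans_le ((min_le_right _ _).trans (min_le_right _ _))⟩
  · intro x hx
    obtain ⟨i, hi⟩ := iUnion_eq_univ_iff.1 hGcov x
    refine ⟨_, ⟨i, rfl⟩, hi, fun hxK => ?_⟩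
    obtain ⟨σ, hσ⟩ := mem_iUnion.1 hxK
    exact hsep σ x hσ hx
  · rw [← image_univ]
    refine (encard_image_filter_le (f := fun i => G i \ ⋃ σ, K σ) (y := x)
      fun _ _ h => h).trans ?_
    by_contra hc
    obtain ⟨t, ht, htG⟩ := exists_finset_of_lt_encard hc
    obtain ⟨i, hi⟩ : t.Nonempty := Finset.card_pos.1 (by omega)
    -- A point in `n + 2` of the new sets would lie in the corresponding `K σ`, which was removed.
    exact (htG i hi).2.2 (mem_iUnion.2 ⟨⟨t, ht⟩, mem_iInter₂.2 fun j hj =>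
      subset_closure (htG j hj).2.1⟩)

theorem theorem8p2 {X Y : Type*} [MetricSpace X] [CompactSpace X]
    [MetricSpace Y] [CompactSpace Y] [ConnectedSpace Y] [Nontrivial Y]
    (n : ℕ) (hX : coveringDim X = ((n + 1 : ℕ) : WithBot ℕ∞)) (hY : IsLC n Y) :
    Dense (lelekMaps n X Y) ∧ IsGδ (lelekMaps n X Y) := by
  have hX' : CoveringDimLT X (n + 2) := coveringDim_le_iff.1 hX.le
  have heq : lelekMaps n X Y = ⋂ q : ℕ × ℕ, {f : C(X, Y) |
      HasSmallCover (unseparatedSet f (1 / (q.1 + 1))) (1 / (q.2 + 1)) (n + 1)} := by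
    ext f
    rw [mem_iInter, Prod.forall]
    exact coveringDim_lelekSet_le_iff f n
  rw [heq]
  -- Baire's theorem in the complete space `C(X, Y)`.
  exact ⟨dense_iInter_of_isOpen (fun q => isOpen_setOf_hasSmallCover_unseparatedSet _ _ _)
      fun q => dense_setOf_hasSmallCover_unseparatedSet hX' hY Nat.one_div_pos_of_nat
        Nat.one_div_pos_of_nat,
    IsGδ.iInter fun q => (isOpen_setOf_hasSmallCover_unseparatedSet _ _ _).isGδ⟩
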